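/- Let the integers $M_{C_1}(m,n)$ and $M_{C_5}(m,n)$ ($m\in\mathbb Z$, $n\in\mathbb Z_{\ge 0}$), the spt-crank-type functions of Garvan and Jennings-Shaffer, be defined by the identities of formal power series in $q$ with coefficients in $\mathbb Z[z,z^{-1}]$ $$\sum_{n\ge 0}\sum_{m\in\mathbb Z} M_{C_1}(m,n)z^mq^n=\sum_{n\ge 1}\frac{q^{n}(q^{2n+1};q^2)_\infty(q^{n+1};q)_\infty}{(zq^n;q)_\infty(z^{-1}q^n;q)_\infty},$$ $$\sum_{n\ge 0}\sum_{m\in\mathbb Z} M_{C_5}(m,n)z^mq^n=\sum_{n\ge 1}\frac{q^{n(n+1)/2}(q^{2n+1};q^2)_\infty(q^{n+1};q)_\infty}{(zq^n;q)_\infty(z^{-1}q^n;q)_\infty},$$ where $(a;b)_\infty=\prod_{i\ge 0}(1-ab^i)$. Then $M_{C_1}(m,n)\ge 0$ and $M_{C_5}(m,n)\ge 0$ for all integers $m$ and all integers $n\ge 0$. -/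

import Mathlib

open scoped PowerSeries LaurentPolynomial PowerSeries.WithPiTopology

noncomputable section

namespace SptCrank

/-- The coefficient ring `ℤ[z, z⁻¹]` carries the discrete topology, so that `ℤ[z, z⁻¹]⟦q⟧` (with the
topology of coefficientwise convergence) carries the usual topology of formal power series, in
which the infinite products and sums below are taken. -/
instance instTopLaurent : TopologicalSpace ℤ[T;T⁻¹] := ⊥

instance instDiscreteLaurent : DiscreteTopology ℤ[T;T⁻¹] := ⟨rfl⟩

/-- The ring `ℤ[z, z⁻¹]⟦q⟧`. -/
abbrev Ser : Type := PowerSeries ℤ[T;T⁻¹]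

/-- The variable `q`. -/
def q : Ser := PowerSeries.X

/-- The power `z ^ m`, for an integer `m`. -/
def zpow (m : ℤ) : Ser := PowerSeries.C (LaurentPolynomial.T m)

/-- The infinite `q`-Pochhammer symbol `(a; b)_∞ = ∏_{i ≥ 0} (1 - a b ^ i)`. -/
def qPoch (a b : Ser) : Ser := ∏' i : ℕ, (1 - a * b ^ i)

/-- The common factor
`(q^{2n+1}; q^2)_∞ (q^{n+1}; q)_∞ / ((z q^n; q)_∞ (z⁻¹ q^n; q)_∞)`.
The denominator is a unit for `n ≥ 1`, see `isUnit_denom`. -/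
def factor (n : ℕ) : Ser :=
  qPoch (q ^ (2 * n + 1)) (q ^ 2) * qPoch (q ^ (n + 1)) q *
    Ring.inverse (qPoch (zpow 1 * q ^ n) q * qPoch (zpow (-1) * q ^ n) q)

/-- The series `S_{C_1}(z, q)`; the summation index `n ≥ 1` of the formula is `k + 1`. -/
def SC1 : Ser := ∑' k : ℕ, q ^ (k + 1) * factor (k + 1)

/-- The series `S_{C_5}(z, q)`; the summation index `n ≥ 1` of the formula is `k + 1`. -/
def SC5 : Ser := ∑' k : ℕ, q ^ ((k + 1) * (k + 2) / 2) * factor (k + 1)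

/-- The coefficient of `z ^ m * q ^ n` in a series. -/
def coeffZQ (m : ℤ) (n : ℕ) (f : Ser) : ℤ := (PowerSeries.coeff n f).coeff m

/-- The function `M_{C_1}(m, n)`. -/
def MC1 (m : ℤ) (n : ℕ) : ℤ := coeffZQ m n SC1

/-- The function `M_{C_5}(m, n)`. -/
def MC5 (m : ℤ) (n : ℕ) : ℤ := coeffZQ m n SC5

/-! The products and sums above converge, and the denominators are invertible. -/

theorem multipliable_qPoch (a b : Ser) (hb : PowerSeries.constantCoeff b = 0) :
    Multipliable fun i : ℕ => 1 - a * b ^ i := by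
  simp_rw [sub_eq_add_neg]
  apply PowerSeries.WithPiTopology.multipliable_one_add_of_tendsto_order_atTop_nhds_top
  refine ENat.tendsto_nhds_top_iff_natCast_lt.mpr
    (fun n => Filter.eventually_atTop.mpr ⟨n + 1, fun m hm => ?_⟩)
  rw [PowerSeries.order_neg]
  have h1 : (m : ℕ∞) ≤ (b ^ m).order := PowerSeries.le_order_pow_of_constantCoeff_eq_zero m hb
  have h2 : (b ^ m).order ≤ (a * b ^ m).order :=
    le_trans (by simp) (PowerSeries.le_order_mul (φ := a) (ψ := b ^ m))
  exact lt_of_lt_of_le (by exact_mod_cast hm) (h1.trans h2)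

theorem constantCoeff_qPoch (a b : Ser) (ha : PowerSeries.constantCoeff a = 0)
    (hb : PowerSeries.constantCoeff b = 0) : PowerSeries.constantCoeff (qPoch a b) = 1 := by
  rw [qPoch, (multipliable_qPoch a b hb).map_tprod _
    (PowerSeries.WithPiTopology.continuous_constantCoeff _)]
  simp [ha]

theorem isUnit_denom (n : ℕ) (hn : 1 ≤ n) :
    IsUnit (qPoch (zpow 1 * q ^ n) q * qPoch (zpow (-1) * q ^ n) q) := by
  have hn' : n ≠ 0 := by omega
  rw [PowerSeries.isUnit_iff_constantCoeff, map_mul, constantCoeff_qPoch, constantCoeff_qPoch] <;>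
    simp [q, hn']

theorem summable_of_le (e : ℕ → ℕ) (he : ∀ k, k ≤ e k) (f : ℕ → Ser) :
    Summable fun k : ℕ => q ^ e k * f k := by
  apply PowerSeries.WithPiTopology.summable_of_tendsto_order_atTop_nhds_top
  refine ENat.tendsto_nhds_top_iff_natCast_lt.mpr
    (fun n => Filter.eventually_atTop.mpr ⟨n + 1, fun m hm => ?_⟩)
  refine lt_of_lt_of_le ?_ (PowerSeries.le_order_mul (φ := q ^ e m) (ψ := f m))
  rw [q, PowerSeries.order_X_pow]
  refine lt_of_lt_of_le ?_ (le_add_of_nonneg_right (by simp))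
  have := he m
  exact_mod_cast (by omega : n < e m)

theorem summable_SC1 : Summable fun k : ℕ => q ^ (k + 1) * factor (k + 1) :=
  summable_of_le _ (fun k => by omega) _

theorem summable_SC5 : Summable fun k : ℕ => q ^ ((k + 1) * (k + 2) / 2) * factor (k + 1) :=
  summable_of_le _ (fun k => by rw [Nat.le_div_iff_mul_le (by norm_num)]; nlinarith) _

end SptCrank

end

noncomputable section

namespace SptCrank

/-! Up to the product `(q; q²)_∞ (q; q)_∞`, each series is `∑ q^n β_n / ((z q^n)_∞ (z⁻¹ q^n)_∞)`
(`factor_eq`), where `β_n = 1/((q; q²)_n (q)_n)` for `C1`, with an extra `q^(n(n-1)/2)` for `C5`.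
These `β_n` belong to Bailey pairs relative to 1 whose `α` is supported on even indices
(`baileyPair_C1`, `baileyPair_C5`). Subtracting the unit Bailey pair removes `α_0` and keeps every
`β_n` with `n ≥ 1` (`sum_alphaDiff`).

Bailey's lemma (`sum_baileyKernel_mul_invTheta`, then `modQ_limit`) turns the series into `1/(q²;
q²)_∞` times `∑ (1 + q^r) δ_r q^r / ((1 - z q^r)(1 - z⁻¹ q^r))` over `r ≥ 1`. Partial fractions show
that `z^m` and `z^(-m)` both have coefficient `∑ δ_r q^(r(m+1)) / (1 - q^r)`, apart from the
product. Expanding geometrically gives a signed sum of monomials `q^((2u+1)e)` over pairs `(u, e)`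
(`modQ_lambert`).

Odd `e`: exchanging the two odd factors matches each negative monomial with an equal positive one
(`isNonneg_oddPart`). Even `e`, `C5`: the index conditions are nested (`isNonneg_evenPart_zero`).
Even `e`, `C1`: an injection pairs each negative monomial with a positive one whose exponent is
smaller by an even number `2k + 2`; the factor `1 - q^(2k+2)` is then absorbed by `1/(q²; q²)_∞`
(`isNonneg_invPochEven_mul_evenPart_one`).

All limits are replaced by congruences modulo powers of `q`. -/

/-! ### Geometric series -/

/-- The geometric series `1 / (1 - f)`, meaningful when `f` has zero constant coefficient. -/
def geom (f : Ser) : Ser := Ring.inverse (1 - f)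

theorem one_sub_mul_geom {f : Ser} (hf : PowerSeries.constantCoeff f = 0) :
    (1 - f) * geom f = 1 := by
  refine Ring.mul_inverse_cancel _ ?_
  rw [PowerSeries.isUnit_iff_constantCoeff]
  simp [hf]

theorem constantCoeff_q_pow {k : ℕ} (hk : k ≠ 0) : PowerSeries.constantCoeff (q ^ k) = 0 := by
  simp [q, hk]

theorem constantCoeff_mul_q_pow (a : Ser) {k : ℕ} (hk : k ≠ 0) :
    PowerSeries.constantCoeff (a * q ^ k) = 0 := by
  simp [q, hk]

theorem one_sub_q_pow_mul_geom {k : ℕ} (hk : k ≠ 0) : (1 - q ^ k) * geom (q ^ k) = 1 :=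
  one_sub_mul_geom (constantCoeff_q_pow hk)

theorem geom_eq_sum_add {f : Ser} (hf : PowerSeries.constantCoeff f = 0) (B : ℕ) :
    geom f = ∑ j ∈ Finset.range B, f ^ j + f ^ B * geom f := by
  have h1 := one_sub_mul_geom hf
  have h2 := mul_neg_geom_sum f B
  linear_combination (∑ j ∈ Finset.range B, f ^ j) * h1 - geom f * h2

theorem isUnit_one_sub_q_pow {k : ℕ} (hk : k ≠ 0) : IsUnit (1 - q ^ k) :=
  IsUnit.of_mul_eq_one _ (one_sub_q_pow_mul_geom hk)

theorem one_add_mul_geom_two_mul {r : ℕ} (hr : r ≠ 0) :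
    (1 + q ^ r) * geom (q ^ (2 * r)) = geom (q ^ r) := by
  have h1 := one_sub_q_pow_mul_geom hr
  have h2 := one_sub_q_pow_mul_geom (k := 2 * r) (by omega)
  have h3 : (1 - q ^ (2 * r)) = (1 - q ^ r) * (1 + q ^ r) := by ring
  rw [h3] at h2
  linear_combination geom (q ^ r) * h2 - (1 + q ^ r) * geom (q ^ (2 * r)) * h1

/-! ### Series with nonnegative coefficients -/

/-- All coefficients of `f` are nonnegative. -/
def IsNonneg (f : Ser) : Prop := ∀ (m : ℤ) (n : ℕ), 0 ≤ coeffZQ m n f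

theorem isNonneg_zero : IsNonneg 0 := fun m n => by simp [coeffZQ]

theorem IsNonneg.add {f g : Ser} (hf : IsNonneg f) (hg : IsNonneg g) : IsNonneg (f + g) := by
  intro m n
  have h : coeffZQ m n (f + g) = coeffZQ m n f + coeffZQ m n g := by simp [coeffZQ]
  rw [h]
  exact add_nonneg (hf m n) (hg m n)

theorem IsNonneg.sum {ι : Type*} {s : Finset ι} {f : ι → Ser} (h : ∀ i ∈ s, IsNonneg (f i)) :
    IsNonneg (∑ i ∈ s, f i) :=
  Finset.sum_induction _ IsNonneg (fun _ _ => IsNonneg.add) isNonneg_zero h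

theorem laurent_mul_nonneg {a b : ℤ[T;T⁻¹]} (ha : ∀ m, 0 ≤ a.coeff m) (hb : ∀ m, 0 ≤ b.coeff m)
    (m : ℤ) : 0 ≤ (a * b).coeff m := by
  classical
  rw [AddMonoidAlgebra.coeff_mul]
  refine Finset.sum_nonneg fun i _ => Finset.sum_nonneg fun j _ => ?_
  dsimp only
  split_ifs
  · exact mul_nonneg (ha i) (hb j)
  · exact le_rfl

theorem IsNonneg.mul {f g : Ser} (hf : IsNonneg f) (hg : IsNonneg g) : IsNonneg (f * g) := by
  intro m n
  rw [coeffZQ, PowerSeries.coeff_mul, AddMonoidAlgebra.coeff_sum, Finsupp.finsetSum_apply]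
  exact Finset.sum_nonneg fun p _ => laurent_mul_nonneg (fun k => hf k p.1) (fun k => hg k p.2) m

theorem isNonneg_zpow (k : ℤ) : IsNonneg (zpow k) := by
  intro m n
  rw [coeffZQ, zpow, PowerSeries.coeff_C]
  split_ifs
  · rw [LaurentPolynomial.T_apply]
    split_ifs <;> simp
  · simp

theorem zpow_zero : zpow 0 = 1 := by simp [zpow]

theorem zpow_mul_zpow (a b : ℤ) : zpow a * zpow b = zpow (a + b) := by
  rw [zpow, zpow, ← map_mul, ← LaurentPolynomial.T_add, zpow]

theorem isNonneg_one : IsNonneg 1 := zpow_zero ▸ isNonneg_zpow 0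

theorem isNonneg_q_pow (k : ℕ) : IsNonneg (q ^ k) := by
  intro m n
  rw [coeffZQ, q, PowerSeries.coeff_X_pow]
  split_ifs
  · simpa [coeffZQ] using isNonneg_one m 0
  · simp

theorem IsNonneg.prod {ι : Type*} {s : Finset ι} {f : ι → Ser} (h : ∀ i ∈ s, IsNonneg (f i)) :
    IsNonneg (∏ i ∈ s, f i) :=
  Finset.prod_induction _ IsNonneg (fun _ _ => IsNonneg.mul) isNonneg_one h

theorem IsNonneg.pow {f : Ser} (hf : IsNonneg f) (k : ℕ) : IsNonneg (f ^ k) := by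
  simpa using IsNonneg.prod (s := Finset.range k) (f := fun _ => f) fun _ _ => hf

/-! ### Reduction modulo a power of `q` -/

/-- Reduction modulo `q ^ B`. -/
def modQ (B : ℕ) : Ser →+* Ser ⧸ Ideal.span {q ^ B} := Ideal.Quotient.mk _

theorem modQ_eq_iff {B : ℕ} {f g : Ser} : modQ B f = modQ B g ↔ q ^ B ∣ f - g := by
  rw [modQ, Ideal.Quotient.eq, Ideal.mem_span_singleton]

theorem modQ_eq_iff_coeff {B : ℕ} {f g : Ser} :
    modQ B f = modQ B g ↔ ∀ j < B, PowerSeries.coeff j f = PowerSeries.coeff j g := by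
  rw [modQ_eq_iff, q, PowerSeries.X_pow_dvd_iff]
  simp only [map_sub, sub_eq_zero]

theorem modQ_q_pow_mul {B k : ℕ} (h : B ≤ k) (f : Ser) : modQ B (q ^ k * f) = 0 := by
  rw [← map_zero (modQ B), modQ_eq_iff, sub_zero]
  exact (pow_dvd_pow q h).mul_right f

theorem modQ_q_pow {B k : ℕ} (h : B ≤ k) : modQ B (q ^ k) = 0 := by
  simpa using modQ_q_pow_mul h 1

theorem isNonneg_of_modQ {f : Ser}
    (h : ∀ B, ∃ g, IsNonneg g ∧ modQ B f = modQ B g) : IsNonneg f := by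
  intro m n
  obtain ⟨g, hg, hfg⟩ := h (n + 1)
  have := modQ_eq_iff_coeff.1 hfg n (Nat.lt_succ_self n)
  rw [coeffZQ, this]
  exact hg m n

theorem isNonneg_geom {k : ℕ} (hk : k ≠ 0) : IsNonneg (geom (q ^ k)) := by
  refine isNonneg_of_modQ fun B => ⟨∑ j ∈ Finset.range B, (q ^ k) ^ j, ?_, ?_⟩
  · exact IsNonneg.sum fun j _ => by rw [← pow_mul]; exact isNonneg_q_pow _
  · conv_lhs => rw [geom_eq_sum_add (constantCoeff_q_pow hk) B]
    rw [map_add, ← pow_mul, modQ_q_pow_mul (Nat.le_mul_of_pos_left B (Nat.pos_of_ne_zero hk)),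
      add_zero]

/-- Multiplying a congruence modulo `q ^ A` by `q ^ r` improves it to one modulo `q ^ (A + r)`. -/
theorem modQ_q_pow_mul_congr {A r B : ℕ} {f g : Ser} (h : modQ A f = modQ A g) (hB : B ≤ A + r) :
    modQ B (q ^ r * f) = modQ B (q ^ r * g) := by
  rw [modQ_eq_iff] at h ⊢
  rw [← mul_sub]
  refine (pow_dvd_pow q hB).trans ?_
  rw [pow_add, mul_comm]
  exact mul_dvd_mul_left _ h

/-! ### Infinite products -/

/-- A congruence modulo `q ^ B` involves finitely many coefficients, each continuous with discrete
values. Hence it passes from finite partial products or sums to the infinite ones. -/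
theorem isClosed_modQ (B : ℕ) (g : Ser) : IsClosed {f : Ser | modQ B f = modQ B g} := by
  simp only [modQ_eq_iff_coeff, Set.ofPred_forall]
  refine isClosed_iInter fun j => isClosed_iInter fun _ => ?_
  exact isClosed_singleton.preimage (PowerSeries.WithPiTopology.continuous_coeff _ j)

theorem qPoch_eq_one_sub_mul (a : Ser) {b : Ser} (hb : PowerSeries.constantCoeff b = 0) :
    qPoch a b = (1 - a) * qPoch (a * b) b := by
  have h : (fun i : ℕ => 1 - a * b ^ (i + 1)) = fun i : ℕ => 1 - a * b * b ^ i := by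
    ext1 i; ring
  rw [qPoch, tprod_eq_zero_mul', h, pow_zero, mul_one, qPoch]
  rw [h]
  exact multipliable_qPoch _ _ hb

theorem modQ_qPoch {B : ℕ} {a b : Ser} (hb : PowerSeries.constantCoeff b = 0) (ha : q ^ B ∣ a) :
    modQ B (qPoch a b) = 1 := by
  have hp : HasProd (fun i : ℕ => 1 - a * b ^ i) (qPoch a b) := (multipliable_qPoch a b hb).hasProd
  rw [← map_one (modQ B)]
  refine (isClosed_modQ B 1).mem_of_tendsto hp (Filter.Eventually.of_forall fun s => ?_)
  simp only [Set.mem_ofPred_eq, map_prod]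
  rw [map_one]
  refine Finset.prod_eq_one fun i _ => ?_
  rw [← map_one (modQ B), modQ_eq_iff, sub_sub_cancel_left, dvd_neg]
  exact ha.mul_right _

theorem constantCoeff_q : PowerSeries.constantCoeff q = 0 := by simp [q]

theorem qPoch_odd_mul_even : qPoch q (q ^ 2) * qPoch (q ^ 2) (q ^ 2) = qPoch q q := by
  have h2 := constantCoeff_q_pow (k := 2) (by norm_num)
  have he : (fun k : ℕ => 1 - q * q ^ (2 * k)) = fun k : ℕ => 1 - q * (q ^ 2) ^ k := by
    ext1 k; rw [pow_mul]
  have ho : (fun k : ℕ => 1 - q * q ^ (2 * k + 1)) = fun k : ℕ => 1 - q ^ 2 * (q ^ 2) ^ k := by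
    ext1 k; ring
  have h := tprod_even_mul_odd (f := fun i : ℕ => 1 - q * q ^ i)
    (by rw [he]; exact multipliable_qPoch _ _ h2) (by rw [ho]; exact multipliable_qPoch _ _ h2)
  rw [he, ho] at h
  exact h

/-! ### Reciprocals of `q`-Pochhammer symbols -/

/-- `1 / (q; q)_k`. -/
def invPoch (k : ℕ) : Ser := ∏ i ∈ Finset.range k, geom (q ^ (i + 1))

/-- `1 / (q; q ^ 2)_k`. -/
def invPochOdd (k : ℕ) : Ser := ∏ i ∈ Finset.range k, geom (q ^ (2 * i + 1))

/-- `1 / (q ^ 2; q ^ 2)_k`. -/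
def invPochEven (k : ℕ) : Ser := ∏ i ∈ Finset.range k, geom (q ^ (2 * i + 2))

/-- `1 / ((z q ^ n; q)_∞ (z⁻¹ q ^ n; q)_∞)`. -/
def invTheta (n : ℕ) : Ser :=
  Ring.inverse (qPoch (zpow 1 * q ^ n) q * qPoch (zpow (-1) * q ^ n) q)

/-- `1 / ((1 - z q ^ r) (1 - z⁻¹ q ^ r))`. -/
def invPair (r : ℕ) : Ser := geom (zpow 1 * q ^ r) * geom (zpow (-1) * q ^ r)

/-- `1 / ((q; q)_{n - s} (q; q)_{n + s})`, read as zero when `n < s`. -/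
def baileyKernel (n s : ℕ) : Ser := if s ≤ n then invPoch (n - s) * invPoch (n + s) else 0

theorem invPoch_succ (k : ℕ) : (1 - q ^ (k + 1)) * invPoch (k + 1) = invPoch k := by
  rw [invPoch, Finset.prod_range_succ, ← invPoch]
  linear_combination invPoch k * one_sub_q_pow_mul_geom (Nat.add_one_ne_zero k)

theorem invPochOdd_succ (k : ℕ) : (1 - q ^ (2 * k + 1)) * invPochOdd (k + 1) = invPochOdd k := by
  rw [invPochOdd, Finset.prod_range_succ, ← invPochOdd]
  linear_combination invPochOdd k * one_sub_q_pow_mul_geom (Nat.add_one_ne_zero (2 * k))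

theorem zpow_one_mul_zpow_neg_one : zpow 1 * zpow (-1) = 1 := by
  rw [zpow_mul_zpow, ← zpow_zero]; norm_num

theorem one_sub_mul_invPair {r : ℕ} (hr : r ≠ 0) :
    (1 - zpow 1 * q ^ r) * (1 - zpow (-1) * q ^ r) * invPair r = 1 := by
  have h1 := one_sub_mul_geom (constantCoeff_mul_q_pow (zpow 1) hr)
  have h2 := one_sub_mul_geom (constantCoeff_mul_q_pow (zpow (-1)) hr)
  rw [invPair]
  linear_combination (1 - zpow (-1) * q ^ r) * geom (zpow (-1) * q ^ r) * h1 + h2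

theorem invTheta_succ {n : ℕ} (hn : n ≠ 0) :
    (1 - zpow 1 * q ^ n) * (1 - zpow (-1) * q ^ n) * invTheta n = invTheta (n + 1) := by
  have h1 := Ring.mul_inverse_cancel _ (isUnit_denom n (Nat.one_le_iff_ne_zero.2 hn))
  have h2 := Ring.mul_inverse_cancel _ (isUnit_denom (n + 1) (Nat.le_add_left 1 n))
  rw [← invTheta] at h1 h2
  rw [qPoch_eq_one_sub_mul (zpow 1 * q ^ n) constantCoeff_q,
    qPoch_eq_one_sub_mul (zpow (-1) * q ^ n) constantCoeff_q] at h1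
  simp only [pow_succ, ← mul_assoc] at h1 h2
  linear_combination invTheta (n + 1) * h1 -
    (1 - zpow 1 * q ^ n) * (1 - zpow (-1) * q ^ n) * invTheta n * h2

theorem baileyKernel_of_lt {n s : ℕ} (h : n < s) : baileyKernel n s = 0 :=
  if_neg (not_le.2 h)

theorem baileyKernel_add (k s : ℕ) :
    baileyKernel (k + s) s = invPoch k * invPoch (k + 2 * s) := by
  rw [baileyKernel, if_pos (Nat.le_add_left s k), Nat.add_sub_cancel, add_assoc, two_mul]

theorem baileyKernel_succ (k s : ℕ) :
    (1 - q ^ (k + 1)) * (1 - q ^ (k + 2 * s + 1)) * baileyKernel (k + 1 + s) s =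
      baileyKernel (k + s) s := by
  rw [baileyKernel_add, baileyKernel_add, ← invPoch_succ k, ← invPoch_succ (k + 2 * s),
    add_right_comm k 1]
  ring

/-- The telescoping form of the `q`-Gauss sum behind Bailey's lemma. -/
theorem sum_baileyKernel_mul_invTheta {r : ℕ} (hr : r ≠ 0) (k : ℕ) :
    ∑ i ∈ Finset.range (k + 1), q ^ (i + r) * baileyKernel (i + r) r * invTheta (i + r) =
      q ^ r * invPair r * baileyKernel (k + r) r * invTheta (k + r + 1) := by
  have hV := one_sub_mul_invPair hr
  induction k with
  | zero =>
    simp only [zero_add, Finset.sum_range_one]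
    rw [← invTheta_succ hr]
    linear_combination -(q ^ r * baileyKernel r r * invTheta r) * hV
  | succ k ih =>
    rw [Finset.sum_range_succ, ih, ← baileyKernel_succ, add_right_comm k r 1,
      ← invTheta_succ (n := k + 1 + r) (by omega)]
    -- With `n = k + 1 + r`, the step is the identity `(1 - q^(k+1))(1 - q^(k+2r+1)) + q^(k+1)(1 - z
    -- q^r)(1 - z⁻¹ q^r) = (1 - z q^n)(1 - z⁻¹ q^n)`.
    linear_combination (-q ^ (k + 1 + r) * baileyKernel (k + 1 + r) r * invTheta (k + 1 + r)) * hV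
      + q ^ r * invPair r * baileyKernel (k + 1 + r) r * invTheta (k + 1 + r) *
        ((q ^ (k + 1)) ^ 2 * q ^ (2 * r) * (-zpow_one_mul_zpow_neg_one) +
          q ^ (k + 1 + 2 * r) * zpow_one_mul_zpow_neg_one)

theorem factor_eq {n : ℕ} :
    factor n = qPoch q (q ^ 2) * qPoch q q * invPochOdd n * invPoch n * invTheta n := by
  rw [factor, ← invTheta]
  congr 1
  induction n with
  | zero => simp [invPochOdd, invPoch]
  | succ n ih =>
    have h2 := constantCoeff_q_pow (k := 2) (by norm_num)
    rw [qPoch_eq_one_sub_mul _ h2, qPoch_eq_one_sub_mul _ constantCoeff_q, ← invPochOdd_succ,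
      ← invPoch_succ] at ih
    have hu := (isUnit_one_sub_q_pow (Nat.add_one_ne_zero (2 * n))).mul
      (isUnit_one_sub_q_pow (Nat.add_one_ne_zero n))
    refine hu.mul_left_cancel ?_
    have e1 : q ^ (2 * n + 1) * q ^ 2 = q ^ (2 * (n + 1) + 1) := by ring
    have e2 : q ^ (n + 1) * q = q ^ (n + 1 + 1) := by ring
    rw [e1, e2] at ih
    linear_combination ih

/-! ### Bailey pairs relative to `1` -/

/-- If `β n = ∑ r, γ r / ((q)_{n-r} (q)_{n+r})`, with `r` from `1` to `n`, this is the
corresponding finite form of Bailey's lemma with parameters `z` and `z⁻¹`. -/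
theorem sum_bailey (β γ : ℕ → Ser)
    (h : ∀ n ≠ 0, β n = ∑ r ∈ Finset.Icc 1 n, γ r * baileyKernel n r) (N : ℕ) :
    ∑ n ∈ Finset.Icc 1 N, q ^ n * β n * invTheta n =
      ∑ r ∈ Finset.Icc 1 N, γ r * (q ^ r * invPair r * baileyKernel N r * invTheta (N + 1)) := by
  have h1 : ∀ n ∈ Finset.Icc 1 N, q ^ n * β n * invTheta n =
      ∑ r ∈ Finset.Icc 1 n, γ r * (q ^ n * baileyKernel n r * invTheta n) := by
    intro n hn
    rw [h n (by rw [Finset.mem_Icc] at hn; omega), Finset.mul_sum, Finset.sum_mul]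
    exact Finset.sum_congr rfl fun r _ => by ring
  have h2 := Finset.sum_comm' (s := Finset.Icc 1 N) (t := fun n => Finset.Icc 1 n)
    (t' := Finset.Icc 1 N) (s' := fun r => Finset.Icc r N)
    (f := fun n r => γ r * (q ^ n * baileyKernel n r * invTheta n))
    (fun x y => by simp only [Finset.mem_Icc]; omega)
  refine (Finset.sum_congr rfl h1).trans (h2.trans ?_)
  refine Finset.sum_congr rfl fun r hr => ?_
  rw [Finset.mem_Icc] at hr
  obtain ⟨k, rfl⟩ := Nat.exists_eq_add_of_le' hr.2
  have h3 := sum_baileyKernel_mul_invTheta (r := r) (by omega) k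
  rw [← Finset.mul_sum, ← h3, ← Finset.Ico_add_one_right_eq_Icc, Finset.sum_Ico_eq_sum_range,
    show k + r + 1 - r = k + 1 by omega]
  simp only [add_comm r]

/-- The partial sums of the unit Bailey pair relation have a closed form, so the full relation
follows by induction on the cutoff. At `R = n - 1` the right side is cancelled by the last term `r =
n`; this is `sum_unit`. -/
theorem sum_range_unit (n R : ℕ) (hn : n ≠ 0) (hR : R < n) :
    (1 - q ^ n) * (∑ r ∈ Finset.Icc 1 R,
      (-1) ^ r * q ^ (r * (r - 1) / 2) * (1 + q ^ r) * baileyKernel n r + baileyKernel n 0) =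
      (-1) ^ R * q ^ (R * (R + 1) / 2) * (invPoch (n - 1 - R) * invPoch (n + R)) := by
  induction R with
  | zero =>
    obtain ⟨k, rfl⟩ := Nat.exists_eq_succ_of_ne_zero hn
    have h := baileyKernel_add (k + 1) 0
    simp only [add_zero, mul_zero] at h
    simp only [Nat.succ_eq_add_one, Nat.add_sub_cancel, Nat.sub_zero, add_zero, h]
    rw [← invPoch_succ k]
    simp
    ring
  | succ R ih =>
    obtain ⟨k, rfl⟩ := Nat.exists_eq_add_of_lt hR
    have h1 : (R + 1 + k + 1 - 1 - R) = k + 1 := by omega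
    have h2 : (R + 1 + k + 1 - 1 - (R + 1)) = k := by omega
    have h3 : (R + 1) * (R + 1 + 1) / 2 = R * (R + 1) / 2 + (R + 1) := by
      rw [show (R + 1) * (R + 1 + 1) = R * (R + 1) + (R + 1) * 2 by ring,
        Nat.add_mul_div_right _ _ (by norm_num)]
    have h4 : (R + 1) * (R + 1 - 1) / 2 = R * (R + 1) / 2 := by
      rw [Nat.add_sub_cancel, mul_comm]
    have ih' := ih (by omega)
    rw [h1] at ih'
    rw [Finset.sum_Icc_succ_top (by omega), h2, h3, h4]
    have h5 : baileyKernel (R + 1 + k + 1) (R + 1) =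
        invPoch (k + 1) * invPoch (R + 1 + k + 1 + (R + 1)) := by
      rw [baileyKernel, if_pos (by omega)]
      congr 2
      omega
    have h6 : invPoch (R + 1 + k + 1 + R) =
        (1 - q ^ (R + 1 + k + 1 + R + 1)) * invPoch (R + 1 + k + 1 + (R + 1)) :=
      (invPoch_succ _).symm
    rw [h5]
    rw [h6] at ih'
    rw [← invPoch_succ k]
    linear_combination ih'

theorem sum_unit {n : ℕ} (hn : n ≠ 0) :
    ∑ r ∈ Finset.Icc 1 n, (-1) ^ r * q ^ (r * (r - 1) / 2) * (1 + q ^ r) * baileyKernel n r +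
      baileyKernel n 0 = 0 := by
  refine (isUnit_one_sub_q_pow hn).mul_left_cancel ?_
  obtain ⟨k, rfl⟩ := Nat.exists_eq_succ_of_ne_zero hn
  have h := sum_range_unit (k + 1) k hn (Nat.lt_succ_self k)
  rw [Nat.succ_eq_add_one, Finset.sum_Icc_succ_top (by omega)]
  have h5 : baileyKernel (k + 1) (k + 1) = invPoch (k + 1 + k + 1) := by
    rw [baileyKernel, if_pos le_rfl, Nat.sub_self, invPoch, Finset.prod_range_zero, one_mul]
    rfl
  have h4 : (k + 1) * (k + 1 - 1) / 2 = k * (k + 1) / 2 := by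
    rw [Nat.add_sub_cancel, mul_comm]
  rw [h4, h5]
  have h6 : invPoch (k + 1 - 1 - k) = 1 := by
    rw [show k + 1 - 1 - k = 0 by omega, invPoch, Finset.prod_range_zero]
  rw [h6, ← invPoch_succ] at h
  linear_combination h

/-! ### The Bailey pairs `C(1)` and `C(5)` -/

/-- Vanishing beyond `n` allows both parity classes to be summed over ranges of length `n`, with no
halved bounds. -/
theorem sum_Icc_parity {A : Type*} [AddCommMonoid A] (f : ℕ → A) (n : ℕ)
    (hf : ∀ r, n < r → f r = 0) :
    ∑ r ∈ Finset.Icc 1 n, f r =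
      ∑ t ∈ Finset.range n, f (2 * t + 1) + ∑ t ∈ Finset.Icc 1 n, f (2 * t) := by
  have h1 : ∑ r ∈ Finset.Icc 1 n, f r = ∑ r ∈ Finset.Icc 1 (2 * n), f r := by
    refine Finset.sum_subset (Finset.Icc_subset_Icc le_rfl (by omega)) fun r hr hr' => hf r ?_
    simp only [Finset.mem_Icc] at hr hr'
    omega
  rw [h1]
  clear h1 hf
  induction n with
  | zero => simp
  | succ n ih =>
    rw [Finset.sum_range_succ, Finset.sum_Icc_succ_top (by omega), mul_add_one,
      Finset.sum_Icc_succ_top (by omega), Finset.sum_Icc_succ_top (by omega), ih]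
    abel

/-- Values of the kernel around `(n, s)`, expressed through a common factor. -/
theorem baileyKernel_neighbours (n s : ℕ) (h : s ≤ n) :
    ∃ X : Ser, baileyKernel (n + 1) (s + 1) = X ∧
      q ^ (s + 1) * baileyKernel n (s + 1) =
        (q ^ (s + 1) - q ^ (n + 1)) * (1 - q ^ (n + s + 2)) * X ∧
      baileyKernel n s = (1 - q ^ (n + s + 1)) * (1 - q ^ (n + s + 2)) * X ∧
      q ^ (2 * s + 2) * baileyKernel n (s + 2) =
        (q ^ (s + 1) - q ^ (n + 1)) * (q ^ (s + 1) - q ^ n) * X := by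
  obtain ⟨k, rfl⟩ := Nat.exists_eq_add_of_le' h
  -- Writing `q^(s+1) - q^(n+1)` for `q^(s+1) (1 - q^(n-s))` keeps exponents natural. These
  -- differences vanish exactly in the boundary cases `n = s` and `n = s + 1`, where the kernel is
  -- zero by convention.
  refine ⟨invPoch k * invPoch (k + 2 * s + 2), ?_, ?_, ?_, ?_⟩
  · rw [add_assoc, baileyKernel_add]
    rfl
  · cases k with
    | zero =>
      rw [baileyKernel_of_lt (by omega)]
      simp
    | succ k =>
      rw [show k + 1 + s = k + (s + 1) by ring, baileyKernel_add, ← invPoch_succ k,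
        show k + 2 * (s + 1) = k + 1 + 2 * s + 1 by ring, ← invPoch_succ (k + 1 + 2 * s + 1)]
      ring
  · rw [baileyKernel_add, ← invPoch_succ (k + 2 * s), ← invPoch_succ (k + 2 * s + 1)]
    ring
  · rcases k with _ | _ | k
    · rw [baileyKernel_of_lt (by omega)]
      simp
    · rw [baileyKernel_of_lt (by omega)]
      ring
    · rw [show k + 1 + 1 + s = k + (s + 2) by ring, baileyKernel_add, ← invPoch_succ k,
        ← invPoch_succ (k + 1), show k + 2 * (s + 2) = k + 1 + 1 + 2 * s + 2 by ring]
      ring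

/-- The first-order recurrence satisfied by `β_n`, applied to one column of the kernel, leaves only
the two adjacent columns. Weighted by the alternating `alphaC`, these cancel between consecutive
`t`. -/
theorem baileyKernel_recurrence_C5 (n s : ℕ) :
    (1 + q ^ (s + 1)) * ((1 - q ^ (n + 1)) * (1 - q ^ (2 * n + 1)) * baileyKernel (n + 1) (s + 1) -
      q ^ n * baileyKernel n (s + 1)) =
        baileyKernel n s + q ^ (s + 1) * baileyKernel n (s + 2) := by
  rcases lt_or_ge n s with h | h
  · simp [baileyKernel_of_lt h, baileyKernel_of_lt (show n < s + 2 by omega),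
      baileyKernel_of_lt (show n < s + 1 by omega),
      baileyKernel_of_lt (show n + 1 < s + 1 by omega)]
  · obtain ⟨X, h1, h2, h3, h4⟩ := baileyKernel_neighbours n s h
    have hq : q ^ (s + 1) ≠ 0 := pow_ne_zero _ PowerSeries.X_ne_zero
    refine mul_left_cancel₀ hq ?_
    rw [h1, h3]
    linear_combination (-(1 + q ^ (s + 1)) * q ^ n) * h2 - h4

theorem baileyKernel_recurrence_C1 (n s : ℕ) :
    q ^ (s + 1) * (1 + q ^ (s + 1)) *
      ((1 - q ^ (n + 1)) * (1 - q ^ (2 * n + 1)) * baileyKernel (n + 1) (s + 1) -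
        baileyKernel n (s + 1)) =
        q ^ (n + 1) * (baileyKernel n s + q ^ (3 * (s + 1)) * baileyKernel n (s + 2)) := by
  rcases lt_or_ge n s with h | h
  · simp [baileyKernel_of_lt h, baileyKernel_of_lt (show n < s + 2 by omega),
      baileyKernel_of_lt (show n < s + 1 by omega),
      baileyKernel_of_lt (show n + 1 < s + 1 by omega)]
  · obtain ⟨X, h1, h2, h3, h4⟩ := baileyKernel_neighbours n s h
    rw [h1, h3]
    linear_combination (-(1 + q ^ (s + 1))) * h2 - q ^ (n + 1) * q ^ (s + 1) * h4

theorem baileyKernel_zero_neighbours (n : ℕ) :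
    ∃ X : Ser, baileyKernel (n + 1) 0 = X ∧ baileyKernel n 0 = (1 - q ^ (n + 1)) ^ 2 * X ∧
      baileyKernel n 1 = (1 - q ^ n) * (1 - q ^ (n + 1)) * X := by
  refine ⟨invPoch (n + 1) * invPoch (n + 1), baileyKernel_add (n + 1) 0, ?_, ?_⟩
  · rw [show baileyKernel n 0 = _ from baileyKernel_add n 0, mul_zero, add_zero, ← invPoch_succ n]
    ring
  · cases n with
    | zero =>
      rw [baileyKernel_of_lt (by omega)]
      simp
    | succ n =>
      rw [baileyKernel_add, ← invPoch_succ n, ← invPoch_succ (n + 1)]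
      ring

/-- The coefficients `α_{2t}`, up to the factor `1 + q ^ (2 * t)`, of the Bailey pairs `C(5)`
(for `l = 0`) and `C(1)` (for `l = 1`). -/
def alphaC (l t : ℕ) : Ser := (-1) ^ t * q ^ ((2 * l + 1) * (t * (t - 1)) + 2 * l * t)

/-- The sum telescopes by `baileyKernel_recurrence_C5`. Its boundary term vanishes once `n < 2 * R +
1`, so the complete sum obeys the recurrence of `β_n`. -/
theorem sum_alphaC5_recurrence (n R : ℕ) :
    (1 - q ^ (n + 1)) * (1 - q ^ (2 * n + 1)) * (∑ t ∈ Finset.Icc 1 R,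
        (1 + q ^ (2 * t)) * alphaC 0 t * baileyKernel (n + 1) (2 * t) + baileyKernel (n + 1) 0) -
      q ^ n * (∑ t ∈ Finset.Icc 1 R, (1 + q ^ (2 * t)) * alphaC 0 t * baileyKernel n (2 * t) +
        baileyKernel n 0) = (-1) ^ R * q ^ (R * (R + 1)) * baileyKernel n (2 * R + 1) := by
  induction R with
  | zero =>
    obtain ⟨X, h1, h2, h3⟩ := baileyKernel_zero_neighbours n
    simp [h1, h2, h3]
    ring
  | succ R ih =>
    have h := baileyKernel_recurrence_C5 n (2 * R + 1)
    rw [Finset.sum_Icc_succ_top (by omega), Finset.sum_Icc_succ_top (by omega), alphaC,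
      Nat.add_sub_cancel]
    rw [show 2 * R + 1 + 1 = 2 * (R + 1) by ring, show 2 * R + 1 + 2 = 2 * (R + 1) + 1 by ring] at h
    linear_combination ih + (-1) ^ (R + 1) * q ^ (R * (R + 1)) * h

theorem sum_alphaC1_recurrence (n R : ℕ) :
    (1 - q ^ (n + 1)) * (1 - q ^ (2 * n + 1)) * (∑ t ∈ Finset.Icc 1 R,
        (1 + q ^ (2 * t)) * alphaC 1 t * baileyKernel (n + 1) (2 * t) + baileyKernel (n + 1) 0) -
      (∑ t ∈ Finset.Icc 1 R, (1 + q ^ (2 * t)) * alphaC 1 t * baileyKernel n (2 * t) +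
        baileyKernel n 0) =
      (-1) ^ R * q ^ (n + 1 + 3 * (R * (R + 1))) * baileyKernel n (2 * R + 1) := by
  induction R with
  | zero =>
    obtain ⟨X, h1, h2, h3⟩ := baileyKernel_zero_neighbours n
    simp [h1, h2, h3]
    ring
  | succ R ih =>
    have h := baileyKernel_recurrence_C1 n (2 * R + 1)
    rw [Finset.sum_Icc_succ_top (by omega), Finset.sum_Icc_succ_top (by omega), alphaC,
      Nat.add_sub_cancel]
    rw [show 2 * R + 1 + 1 = 2 * (R + 1) by ring, show 2 * R + 1 + 2 = 2 * (R + 1) + 1 by ring] at h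
    linear_combination ih + (-1) ^ (R + 1) * q ^ (3 * (R * (R + 1))) * h

theorem invPochOdd_mul_invPoch_succ (n : ℕ) :
    (1 - q ^ (n + 1)) * (1 - q ^ (2 * n + 1)) * (invPochOdd (n + 1) * invPoch (n + 1)) =
      invPochOdd n * invPoch n := by
  rw [← invPochOdd_succ n, ← invPoch_succ n]
  ring

theorem isUnit_one_sub_mul_one_sub (n : ℕ) :
    IsUnit ((1 - q ^ (n + 1)) * (1 - q ^ (2 * n + 1))) :=
  (isUnit_one_sub_q_pow (Nat.add_one_ne_zero n)).mul
    (isUnit_one_sub_q_pow (Nat.add_one_ne_zero (2 * n)))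

theorem sum_Icc_kernel_succ (α : ℕ → Ser) (n : ℕ) :
    ∑ t ∈ Finset.Icc 1 (n + 1), (1 + q ^ (2 * t)) * α t * baileyKernel n (2 * t) =
      ∑ t ∈ Finset.Icc 1 n, (1 + q ^ (2 * t)) * α t * baileyKernel n (2 * t) := by
  rw [Finset.sum_Icc_succ_top (by omega), baileyKernel_of_lt (by omega), mul_zero, add_zero]

theorem baileyPair_C5 (n : ℕ) :
    ∑ t ∈ Finset.Icc 1 n, (1 + q ^ (2 * t)) * alphaC 0 t * baileyKernel n (2 * t) +
      baileyKernel n 0 = q ^ (n * (n - 1) / 2) * (invPochOdd n * invPoch n) := by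
  induction n with
  | zero => simp [baileyKernel, invPoch, invPochOdd]
  | succ n ih =>
    have h := sum_alphaC5_recurrence n (n + 1)
    rw [sum_Icc_kernel_succ (alphaC 0) n, ih, baileyKernel_of_lt (show n < 2 * (n + 1) + 1 by omega), mul_zero,
      sub_eq_zero] at h
    refine (isUnit_one_sub_mul_one_sub n).mul_left_cancel ?_
    rw [h, ← invPochOdd_mul_invPoch_succ]
    have e : (n + 1) * (n + 1 - 1) / 2 = n + n * (n - 1) / 2 := by
      cases n with
      | zero => rfl
      | succ n =>
        simp only [Nat.add_sub_cancel]
        rw [show (n + 1 + 1) * (n + 1) = (n + 1) * n + (n + 1) * 2 by ring,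
          Nat.add_mul_div_right _ _ (by norm_num), add_comm]
    rw [e, pow_add]
    ring

theorem baileyPair_C1 (n : ℕ) :
    ∑ t ∈ Finset.Icc 1 n, (1 + q ^ (2 * t)) * alphaC 1 t * baileyKernel n (2 * t) +
      baileyKernel n 0 = invPochOdd n * invPoch n := by
  induction n with
  | zero => simp [baileyKernel, invPoch, invPochOdd]
  | succ n ih =>
    have h := sum_alphaC1_recurrence n (n + 1)
    rw [sum_Icc_kernel_succ (alphaC 1) n, ih, baileyKernel_of_lt (show n < 2 * (n + 1) + 1 by omega), mul_zero,
      sub_eq_zero] at h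
    refine (isUnit_one_sub_mul_one_sub n).mul_left_cancel ?_
    rw [h, ← invPochOdd_mul_invPoch_succ]

/-- The difference of a Bailey pair supported on even indices and the unit Bailey pair, up to the
factor `1 + q ^ r`. -/
def alphaDiff (α : ℕ → Ser) (r : ℕ) : Ser :=
  (if Even r then α (r / 2) else 0) - (-1) ^ r * q ^ (r * (r - 1) / 2)

/-- The unit pair has `β_n = 0` for `n ≠ 0` and `α_0 = 1`, so subtracting it costs nothing and
removes the index `r = 0`, which would bring in the non-invertible `(1 - z)(1 - z⁻¹)`. -/
theorem sum_alphaDiff (α : ℕ → Ser) {n : ℕ} (hn : n ≠ 0) :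
    ∑ r ∈ Finset.Icc 1 n, (1 + q ^ r) * alphaDiff α r * baileyKernel n r =
      ∑ t ∈ Finset.Icc 1 n, (1 + q ^ (2 * t)) * α t * baileyKernel n (2 * t) +
        baileyKernel n 0 := by
  have h1 := sum_unit hn
  have h2 := sum_Icc_parity
    (fun r => if Even r then (1 + q ^ r) * α (r / 2) * baileyKernel n r else 0) n
    (fun r hr => by simp [baileyKernel_of_lt hr])
  simp only [Nat.not_even_two_mul_add_one, if_false, Finset.sum_const_zero, zero_add,
    even_two_mul, if_true, Nat.mul_div_cancel_left _ (Nat.succ_pos 1)] at h2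
  have h3 : ∀ r ∈ Finset.Icc 1 n, (1 + q ^ r) * alphaDiff α r * baileyKernel n r =
      (if Even r then (1 + q ^ r) * α (r / 2) * baileyKernel n r else 0) -
        (-1) ^ r * q ^ (r * (r - 1) / 2) * (1 + q ^ r) * baileyKernel n r := by
    intro r _
    rw [alphaDiff]
    split_ifs <;> ring
  rw [Finset.sum_congr rfl h3, Finset.sum_sub_distrib]
  linear_combination h2 - h1

/-! ### The coefficients of the powers of `z` -/

theorem qPoch_mul_prod_geom (a b k : ℕ) (ha : a ≠ 0) (hb : b ≠ 0) :
    qPoch (q ^ a) (q ^ b) * ∏ i ∈ Finset.range k, geom (q ^ (b * i + a)) =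
      qPoch (q ^ (b * k + a)) (q ^ b) := by
  induction k with
  | zero => simp
  | succ k ih =>
    have h := one_sub_q_pow_mul_geom (k := b * k + a) (by omega)
    rw [Finset.prod_range_succ, ← mul_assoc, ih, qPoch_eq_one_sub_mul _ (constantCoeff_q_pow hb),
      ← pow_add, show b * k + a + b = b * (k + 1) + a by ring]
    linear_combination qPoch (q ^ (b * (k + 1) + a)) (q ^ b) * h

theorem qPoch_mul_invPoch (k : ℕ) : qPoch q q * invPoch k = qPoch (q ^ (k + 1)) q := by
  simpa [invPoch] using qPoch_mul_prod_geom 1 1 k one_ne_zero one_ne_zero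

theorem qPoch_mul_invPochEven (k : ℕ) :
    qPoch (q ^ 2) (q ^ 2) * invPochEven k = qPoch (q ^ (2 * k + 2)) (q ^ 2) :=
  qPoch_mul_prod_geom 2 2 k two_ne_zero two_ne_zero

theorem modQ_qPoch_mul_invPoch {B k : ℕ} (h : B ≤ k + 1) :
    modQ B (qPoch q q * invPoch k) = 1 := by
  rw [qPoch_mul_invPoch]
  exact modQ_qPoch constantCoeff_q (pow_dvd_pow q h)

theorem modQ_qPoch_mul_invPochEven {B k : ℕ} (h : B ≤ 2 * k + 2) :
    modQ B (qPoch (q ^ 2) (q ^ 2) * invPochEven k) = 1 := by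
  rw [qPoch_mul_invPochEven]
  exact modQ_qPoch (constantCoeff_q_pow two_ne_zero) (pow_dvd_pow q h)

theorem modQ_invTheta {B n : ℕ} (hn : n ≠ 0) (h : B ≤ n) : modQ B (invTheta n) = 1 := by
  have h1 := congrArg (modQ B)
    (Ring.mul_inverse_cancel _ (isUnit_denom n (Nat.one_le_iff_ne_zero.2 hn)))
  rw [← invTheta, map_mul, map_mul,
    modQ_qPoch constantCoeff_q ((pow_dvd_pow q h).mul_left _),
    modQ_qPoch constantCoeff_q ((pow_dvd_pow q h).mul_left _)] at h1
  simpa using h1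

/-- Truncated form of the limit of Bailey's lemma: the kernel tends to `1/(q)_∞²`, and `(q; q²)_∞ /
(q; q)_∞ = 1/(q²; q²)_∞`. The freedom in `M` lets the last product be cut as late as the positivity
argument needs. -/
theorem modQ_limit {N M r : ℕ} (hM : N ≤ M) (hr : r ≤ N) :
    modQ (N + 1) (qPoch q (q ^ 2) * qPoch q q * (q ^ r * baileyKernel N r * invTheta (N + 1))) =
      modQ (N + 1) (q ^ r * invPochEven M) := by
  -- The product up to `N - r` is accurate only modulo `q^(N-r+1)`; the factor `q^r` restores the
  -- lost precision.
  have h1 : modQ (N + 1) (q ^ r * (qPoch q q * invPoch (N - r))) = modQ (N + 1) (q ^ r * 1) :=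
    modQ_q_pow_mul_congr (A := N - r + 1)
      ((modQ_qPoch_mul_invPoch le_rfl).trans (map_one _).symm) (by omega)
  have h2 := modQ_qPoch_mul_invPoch (B := N + 1) (k := N + r) (by omega)
  have h3 := modQ_qPoch_mul_invPochEven (B := N + 1) (k := M) (by omega)
  have h4 := modQ_invTheta (B := N + 1) (Nat.add_one_ne_zero N) le_rfl
  rw [← qPoch_odd_mul_even] at h2
  rw [baileyKernel, if_pos hr]
  simp only [map_mul, map_one] at h1 h2 h3 h4 ⊢
  linear_combination (modQ (N + 1) (qPoch q (q ^ 2)) * modQ (N + 1) (invPoch (N + r)) *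
      modQ (N + 1) (invTheta (N + 1))) * h1 +
    modQ (N + 1) (q ^ r) * modQ (N + 1) (qPoch q (q ^ 2)) * modQ (N + 1) (invPoch (N + r)) * h4 -
    modQ (N + 1) (q ^ r) * modQ (N + 1) (qPoch q (q ^ 2)) * modQ (N + 1) (invPoch (N + r)) * h3 +
    modQ (N + 1) (q ^ r) * modQ (N + 1) (invPochEven M) * h2

/-- Partial fractions: if `xy = q^(2r)`, then `1 - q^(2r) = (1 - y) + y (1 - x)`. Nonnegative and
negative powers of `z` are thereby separated. -/
theorem invPair_eq_geom_mul {r : ℕ} (hr : r ≠ 0) :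
    invPair r = geom (q ^ (2 * r)) *
      (geom (zpow 1 * q ^ r) + zpow (-1) * q ^ r * geom (zpow (-1) * q ^ r)) := by
  have h1 := one_sub_mul_geom (constantCoeff_mul_q_pow (zpow 1) hr)
  have h2 := one_sub_mul_geom (constantCoeff_mul_q_pow (zpow (-1)) hr)
  have h3 := one_sub_q_pow_mul_geom (k := 2 * r) (by omega)
  have h4 : (zpow 1 * q ^ r) * (zpow (-1) * q ^ r) = q ^ (2 * r) := by
    rw [mul_mul_mul_comm, zpow_one_mul_zpow_neg_one]
    ring
  rw [invPair]
  set x := zpow 1 * q ^ r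
  set y := zpow (-1) * q ^ r
  have h5 : (1 - q ^ (2 * r)) * (geom x * geom y) = geom x + y * geom y := by
    rw [← h4]
    linear_combination geom x * h2 + y * geom y * h1
  rw [← h5]
  linear_combination -(geom x * geom y) * h3

/-- The truncated coefficient of `z ^ m` and of `z ^ (-m)`, without the factor
`1 / (q ^ 2; q ^ 2)_∞`. -/
def lambert (δ : ℕ → Ser) (N m : ℕ) : Ser :=
  ∑ r ∈ Finset.Icc 1 N, δ r * (q ^ (r * (m + 1)) * geom (q ^ r))

theorem modQ_geom_zpow {N r : ℕ} (hr : r ≠ 0) (k : ℤ) :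
    modQ (N + 1) (geom (zpow k * q ^ r)) =
      modQ (N + 1) (∑ j ∈ Finset.range (N + 1), zpow k ^ j * q ^ (r * j)) := by
  conv_lhs => rw [geom_eq_sum_add (constantCoeff_mul_q_pow (zpow k) hr) (N + 1)]
  have h : modQ (N + 1) ((zpow k * q ^ r) ^ (N + 1) * geom (zpow k * q ^ r)) = 0 := by
    rw [mul_pow, ← pow_mul, mul_right_comm, mul_comm]
    exact modQ_q_pow_mul (Nat.le_mul_of_pos_left _ (Nat.pos_of_ne_zero hr)) _
  rw [map_add, h, add_zero]
  simp only [mul_pow, pow_mul]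

theorem modQ_sum_invPair (δ : ℕ → Ser) (N : ℕ) :
    modQ (N + 1) (∑ r ∈ Finset.Icc 1 N, (1 + q ^ r) * δ r * (q ^ r * invPair r)) =
      modQ (N + 1) (∑ j ∈ Finset.range (N + 1), zpow 1 ^ j * lambert δ N j +
        ∑ j ∈ Finset.range (N + 1), zpow (-1) ^ (j + 1) * lambert δ N (j + 1)) := by
  have h1 : ∀ r ∈ Finset.Icc 1 N, modQ (N + 1) ((1 + q ^ r) * δ r * (q ^ r * invPair r)) =
      modQ (N + 1) (∑ j ∈ Finset.range (N + 1),
          zpow 1 ^ j * (δ r * (q ^ (r * (j + 1)) * geom (q ^ r))) +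
        ∑ j ∈ Finset.range (N + 1),
          zpow (-1) ^ (j + 1) * (δ r * (q ^ (r * (j + 1 + 1)) * geom (q ^ r)))) := by
    intro r hr
    have hr0 : r ≠ 0 := by rw [Finset.mem_Icc] at hr; omega
    have e : (1 + q ^ r) * δ r * (q ^ r * invPair r) = δ r * q ^ r * geom (q ^ r) *
        (geom (zpow 1 * q ^ r) + zpow (-1) * q ^ r * geom (zpow (-1) * q ^ r)) := by
      rw [invPair_eq_geom_mul hr0, ← one_add_mul_geom_two_mul hr0]
      ring
    rw [e, map_mul, map_add, map_mul _ (zpow (-1) * q ^ r), modQ_geom_zpow hr0, modQ_geom_zpow hr0,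
      ← map_mul _ (zpow (-1) * q ^ r), ← map_add, ← map_mul, mul_add]
    congr 2
    · rw [Finset.mul_sum]
      exact Finset.sum_congr rfl fun j _ => by ring
    · rw [Finset.mul_sum, Finset.mul_sum]
      exact Finset.sum_congr rfl fun j _ => by ring
  rw [map_sum, Finset.sum_congr rfl h1, ← map_sum, Finset.sum_add_distrib, Finset.sum_comm,
    Finset.sum_comm (s := Finset.Icc 1 N) (t := Finset.range (N + 1))]
  simp only [lambert, Finset.mul_sum]

theorem modQ_tsum {e : ℕ → ℕ} (he : ∀ k, k < e k) (f : ℕ → Ser) (N : ℕ) :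
    modQ (N + 1) (∑' k, q ^ e k * f k) =
      modQ (N + 1) (∑ k ∈ Finset.range N, q ^ e k * f k) := by
  have hs : HasSum (fun k => q ^ e k * f k) (∑' k, q ^ e k * f k) :=
    (summable_of_le e (fun k => (he k).le) f).hasSum
  refine (isClosed_modQ (N + 1) _).mem_of_tendsto hs ?_
  filter_upwards [Filter.eventually_ge_atTop (Finset.range N)] with s hsub
  change modQ (N + 1) (∑ k ∈ s, q ^ e k * f k) = _
  rw [map_sum, map_sum]
  refine (Finset.sum_subset hsub fun k _ hk => modQ_q_pow_mul ?_ _).symm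
  have := he k
  rw [Finset.mem_range] at hk
  omega

/-- A series `∑ q ^ n β n / ((z q ^ n) (z⁻¹ q ^ n))` attached to a Bailey pair has nonnegative
coefficients as soon as all its coefficients of powers of `z` do. -/
theorem isNonneg_tsum_factor (w : ℕ → ℕ) (δ : ℕ → Ser) (M : ℕ → ℕ) (hM : ∀ N, N ≤ M N)
    (hβ : ∀ n ≠ 0, q ^ w n * (invPochOdd n * invPoch n) =
      ∑ r ∈ Finset.Icc 1 n, (1 + q ^ r) * δ r * baileyKernel n r)
    (hL : ∀ N m, ∃ g, IsNonneg g ∧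
      modQ (N + 1) (invPochEven (M N) * lambert δ N m) = modQ (N + 1) g) :
    IsNonneg (∑' k : ℕ, q ^ (k + 1 + w (k + 1)) * factor (k + 1)) := by
  refine isNonneg_of_modQ fun B => ?_
  suffices h : ∃ g, IsNonneg g ∧
      modQ (B + 1) (∑' k : ℕ, q ^ (k + 1 + w (k + 1)) * factor (k + 1)) = modQ (B + 1) g by
    obtain ⟨g, hg, h⟩ := h
    refine ⟨g, hg, ?_⟩
    rw [modQ_eq_iff_coeff] at h ⊢
    exact fun j hj => h j (by omega)
  choose g hg hgL using hL B
  refine ⟨∑ j ∈ Finset.range (B + 1), zpow 1 ^ j * g j +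
    ∑ j ∈ Finset.range (B + 1), zpow (-1) ^ (j + 1) * g (j + 1), ?_, ?_⟩
  · refine IsNonneg.add (IsNonneg.sum fun j _ => IsNonneg.mul ?_ (hg _))
      (IsNonneg.sum fun j _ => IsNonneg.mul ?_ (hg _))
    · exact (isNonneg_zpow 1).pow j
    · exact (isNonneg_zpow (-1)).pow (j + 1)
  · have h1 : ∑ k ∈ Finset.range B, q ^ (k + 1 + w (k + 1)) * factor (k + 1) =
        qPoch q (q ^ 2) * qPoch q q * ∑ n ∈ Finset.Icc 1 B,
          q ^ n * (q ^ w n * (invPochOdd n * invPoch n)) * invTheta n := by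
      rw [← Finset.Ico_add_one_right_eq_Icc, Finset.sum_Ico_eq_sum_range, Finset.mul_sum,
        Nat.add_sub_cancel]
      refine Finset.sum_congr rfl fun k _ => ?_
      rw [factor_eq, add_comm 1 k]
      ring
    have h2 : modQ (B + 1) (qPoch q (q ^ 2) * qPoch q q * ∑ r ∈ Finset.Icc 1 B,
        (1 + q ^ r) * δ r * (q ^ r * invPair r * baileyKernel B r * invTheta (B + 1))) =
        modQ (B + 1) (invPochEven (M B) *
          ∑ r ∈ Finset.Icc 1 B, (1 + q ^ r) * δ r * (q ^ r * invPair r)) := by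
      rw [Finset.mul_sum, Finset.mul_sum, map_sum, map_sum]
      refine Finset.sum_congr rfl fun r hr => ?_
      have h3 := modQ_limit (hM B) (Finset.mem_Icc.1 hr).2
      simp only [map_mul] at h3 ⊢
      linear_combination modQ (B + 1) (1 + q ^ r) * modQ (B + 1) (δ r) *
        modQ (B + 1) (invPair r) * h3
    rw [modQ_tsum (fun k => by omega), h1,
      sum_bailey (fun n => q ^ w n * (invPochOdd n * invPoch n)) (fun r => (1 + q ^ r) * δ r) hβ, h2,
      map_mul, modQ_sum_invPair, ← map_mul, mul_add, Finset.mul_sum, Finset.mul_sum]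
    simp only [map_add, map_sum, map_mul] at hgL ⊢
    congr 1
    · refine Finset.sum_congr rfl fun j _ => ?_
      rw [← hgL]
      ring
    · refine Finset.sum_congr rfl fun j _ => ?_
      rw [← hgL]
      ring

/-! ### Positivity -/

theorem modQ_q_pow_mul_geom {N K s t : ℕ} (ht : t ≠ 0) (hK : N + 1 ≤ s + t * K) (c : ℕ) :
    modQ (N + 1) (q ^ (s + t * c) * geom (q ^ t)) =
      modQ (N + 1) (∑ u ∈ Finset.range K, if c ≤ u then q ^ (s + t * u) else 0) := by
  rcases le_total c K with h | h
  · obtain ⟨k, rfl⟩ := Nat.exists_eq_add_of_le h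
    have e : ∑ u ∈ Finset.range (c + k), (if c ≤ u then q ^ (s + t * u) else 0) =
        q ^ (s + t * c) * ∑ j ∈ Finset.range k, (q ^ t) ^ j := by
      rw [Finset.sum_range_add, Finset.sum_eq_zero, zero_add, Finset.mul_sum]
      · refine Finset.sum_congr rfl fun j _ => ?_
        rw [if_pos (Nat.le_add_right c j)]
        ring
      · intro u hu
        rw [Finset.mem_range] at hu
        exact if_neg (by omega)
    rw [e]
    conv_lhs => rw [geom_eq_sum_add (constantCoeff_q_pow ht) k]
    have h0 : modQ (N + 1) (q ^ (s + t * c + t * k) * geom (q ^ t)) = 0 :=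
      modQ_q_pow_mul (by rw [add_assoc, ← mul_add]; exact hK) _
    rw [mul_add, map_add, ← mul_assoc _ ((q ^ t) ^ k), ← pow_mul, ← pow_add, h0, add_zero]
  · rw [modQ_q_pow_mul (hK.trans (Nat.add_le_add_left (Nat.mul_le_mul_left t h) s)),
      Finset.sum_eq_zero, map_zero]
    intro u hu
    rw [Finset.mem_range] at hu
    exact if_neg (by omega)

theorem modQ_geom_even (N d c : ℕ) (hd : d ≠ 0) :
    modQ (N + 1) (q ^ (d * (c + 1)) * geom (q ^ d)) =
      modQ (N + 1) (∑ e ∈ Finset.Icc 1 N, if c < e then q ^ (d * e) else 0) := by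
  have h := modQ_q_pow_mul_geom (N := N) (K := N) (s := d) hd
    (by nlinarith [Nat.pos_of_ne_zero hd]) c
  rw [← Finset.Ico_add_one_right_eq_Icc, Finset.sum_Ico_eq_sum_range, Nat.add_sub_cancel]
  rw [show d * (c + 1) = d + d * c by ring, h]
  congr 1
  refine Finset.sum_congr rfl fun u _ => ?_
  rw [show d * (1 + u) = d + d * u by ring]
  exact if_congr (by omega) rfl rfl

theorem modQ_geom_odd (N e c : ℕ) (he : e ≠ 0) :
    modQ (N + 1) (q ^ ((2 * c + 1) * e) * geom (q ^ (2 * e))) =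
      modQ (N + 1) (∑ u ∈ Finset.range N, if c ≤ u then q ^ ((2 * u + 1) * e) else 0) := by
  have h := modQ_q_pow_mul_geom (N := N) (K := N) (s := e) (t := 2 * e) (by omega)
    (by nlinarith [Nat.pos_of_ne_zero he]) c
  rw [show (2 * c + 1) * e = e + 2 * e * c by ring, h]
  congr 1
  refine Finset.sum_congr rfl fun u _ => ?_
  rw [show (2 * u + 1) * e = e + 2 * e * u by ring]

/-- Odd `r = 2u + 1` gives positive monomials `q^(r e)` with `e > u + m`; even `r = 2e` gives
negative monomials `q^((2u+1)e)` with `u ≥ e + m`. Both are thus indexed by the same pairs `(u, e)`.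
-/
theorem modQ_unit_part (N m : ℕ) :
    modQ (N + 1) (∑ r ∈ Finset.Icc 1 N,
        -((-1) ^ r * q ^ (r * (r - 1) / 2)) * (q ^ (r * (m + 1)) * geom (q ^ r))) =
      modQ (N + 1) (∑ u ∈ Finset.range N, ∑ e ∈ Finset.Icc 1 N,
        ((if u + m < e then q ^ ((2 * u + 1) * e) else 0) -
          (if e + m ≤ u then q ^ ((2 * u + 1) * e) else 0))) := by
  rw [map_sum, sum_Icc_parity]
  · simp only [Finset.sum_sub_distrib]
    rw [Finset.sum_comm (s := Finset.range N) (t := Finset.Icc 1 N)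
      (f := fun u e => if e + m ≤ u then q ^ ((2 * u + 1) * e) else 0), map_sub, map_sum, map_sum,
      sub_eq_add_neg, ← Finset.sum_neg_distrib]
    congr 1
    · refine Finset.sum_congr rfl fun u _ => ?_
      rw [← modQ_geom_even N _ _ (by omega)]
      congr 1
      have e1 : (2 * u + 1) * (2 * u + 1 - 1) / 2 = (2 * u + 1) * u := by
        rw [Nat.add_sub_cancel, mul_left_comm, Nat.mul_div_cancel_left _ (by norm_num)]
      rw [e1, Odd.neg_one_pow ⟨u, rfl⟩]
      ring
    · refine Finset.sum_congr rfl fun e he => ?_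
      have he0 : e ≠ 0 := by rw [Finset.mem_Icc] at he; omega
      rw [← modQ_geom_odd N e _ he0, ← map_neg]
      congr 1
      obtain ⟨v, rfl⟩ := Nat.exists_eq_succ_of_ne_zero he0
      have e1 : 2 * (v + 1) * (2 * (v + 1) - 1) / 2 = (v + 1) * (2 * v + 1) := by
        rw [mul_assoc, Nat.mul_div_cancel_left _ (by norm_num)]
        rfl
      rw [Nat.succ_eq_add_one, e1, Even.neg_one_pow ⟨v + 1, two_mul _⟩]
      ring
  · intro r hr
    rw [mul_left_comm]
    exact modQ_q_pow_mul (by nlinarith) _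

theorem modQ_alphaC_part (l N m : ℕ) :
    modQ (N + 1) (∑ t ∈ Finset.Icc 1 N,
        alphaC l t * (q ^ (2 * t * (m + 1)) * geom (q ^ (2 * t)))) =
      modQ (N + 1) (∑ u ∈ Finset.range N, ∑ e ∈ Finset.Icc 1 N,
        ((if (2 * l + 1) * e + m ≤ u then q ^ ((2 * u + 1) * (2 * e)) else 0) -
          (if (2 * l + 1) * u + l + m < e then q ^ ((2 * u + 1) * (2 * e)) else 0))) := by
  rw [map_sum, sum_Icc_parity]
  · simp only [Finset.sum_sub_distrib]
    rw [Finset.sum_comm (s := Finset.range N) (t := Finset.Icc 1 N)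
      (f := fun u e => if (2 * l + 1) * e + m ≤ u then q ^ ((2 * u + 1) * (2 * e)) else 0), map_sub,
      map_sum, map_sum, sub_eq_add_neg, ← Finset.sum_neg_distrib]
    refine (add_comm _ _).trans ?_
    congr 1
    · refine Finset.sum_congr rfl fun e he => ?_
      have he0 : e ≠ 0 := by rw [Finset.mem_Icc] at he; omega
      rw [← modQ_geom_odd N (2 * e) _ (by omega)]
      congr 1
      obtain ⟨v, rfl⟩ := Nat.exists_eq_succ_of_ne_zero he0
      rw [alphaC, Even.neg_one_pow ⟨v.succ, two_mul _⟩, Nat.succ_eq_add_one,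
        show 2 * (v + 1) - 1 = 2 * v + 1 by omega]
      ring
    · refine Finset.sum_congr rfl fun u _ => ?_
      have h := modQ_geom_even N (2 * (2 * u + 1)) ((2 * l + 1) * u + l + m) (by omega)
      rw [show ∑ e ∈ Finset.Icc 1 N, (if (2 * l + 1) * u + l + m < e then
          q ^ ((2 * u + 1) * (2 * e)) else 0) = ∑ e ∈ Finset.Icc 1 N,
          (if (2 * l + 1) * u + l + m < e then q ^ (2 * (2 * u + 1) * e) else 0) from
        Finset.sum_congr rfl fun e _ => by rw [mul_left_comm, mul_assoc], ← h, ← map_neg]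
      congr 1
      rw [alphaC, Odd.neg_one_pow ⟨u, rfl⟩, Nat.add_sub_cancel]
      ring
  · intro t ht
    rw [mul_left_comm]
    exact modQ_q_pow_mul (by nlinarith) _

/-- The contribution of the products of two odd numbers. -/
def oddPart (N m : ℕ) : Ser :=
  ∑ u ∈ Finset.range N, ∑ w ∈ Finset.range N,
    ((if u + m ≤ 2 * w then q ^ ((2 * u + 1) * (2 * w + 1)) else 0) -
      (if 2 * w + 1 + m ≤ u then q ^ ((2 * u + 1) * (2 * w + 1)) else 0))

/-- The contribution of the products of an odd and an even number. -/
def evenPart (l N m : ℕ) : Ser :=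
  ∑ u ∈ Finset.range N, ∑ e ∈ Finset.Icc 1 N,
    ((if u + m < 2 * e then q ^ ((2 * u + 1) * (2 * e)) else 0) -
      (if 2 * e + m ≤ u then q ^ ((2 * u + 1) * (2 * e)) else 0) +
      ((if (2 * l + 1) * e + m ≤ u then q ^ ((2 * u + 1) * (2 * e)) else 0) -
        (if (2 * l + 1) * u + l + m < e then q ^ ((2 * u + 1) * (2 * e)) else 0)))

/-- The `alphaC` part contains only monomials `q^((2u+1)·2e)`, so the unit part is split by the
parity of its second factor, and only the even half interacts with it. -/
theorem modQ_lambert (l N m : ℕ) :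
    modQ (N + 1) (lambert (alphaDiff (alphaC l)) N m) =
      modQ (N + 1) (oddPart N m + evenPart l N m) := by
  have h1 : lambert (alphaDiff (alphaC l)) N m =
      ∑ r ∈ Finset.Icc 1 N, (if Even r then
        alphaC l (r / 2) * (q ^ (r * (m + 1)) * geom (q ^ r)) else 0) +
      ∑ r ∈ Finset.Icc 1 N,
        -((-1) ^ r * q ^ (r * (r - 1) / 2)) * (q ^ (r * (m + 1)) * geom (q ^ r)) := by
    rw [lambert, ← Finset.sum_add_distrib]
    refine Finset.sum_congr rfl fun r _ => ?_
    rw [alphaDiff]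
    split_ifs <;> ring
  have h2 : modQ (N + 1) (∑ r ∈ Finset.Icc 1 N, (if Even r then
        alphaC l (r / 2) * (q ^ (r * (m + 1)) * geom (q ^ r)) else 0)) =
      modQ (N + 1) (∑ t ∈ Finset.Icc 1 N,
        alphaC l t * (q ^ (2 * t * (m + 1)) * geom (q ^ (2 * t)))) := by
    rw [map_sum, sum_Icc_parity, map_sum]
    · simp
    · intro r hr
      split_ifs
      · rw [mul_left_comm]
        exact modQ_q_pow_mul (by nlinarith) _
      · exact map_zero _
  have h3 : modQ (N + 1) (∑ u ∈ Finset.range N, ∑ e ∈ Finset.Icc 1 N,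
        ((if u + m < e then q ^ ((2 * u + 1) * e) else 0) -
          (if e + m ≤ u then q ^ ((2 * u + 1) * e) else 0))) =
      modQ (N + 1) (oddPart N m + ∑ u ∈ Finset.range N, ∑ e ∈ Finset.Icc 1 N,
        ((if u + m < 2 * e then q ^ ((2 * u + 1) * (2 * e)) else 0) -
          (if 2 * e + m ≤ u then q ^ ((2 * u + 1) * (2 * e)) else 0))) := by
    rw [oddPart, ← Finset.sum_add_distrib, map_sum, map_sum]
    refine Finset.sum_congr rfl fun u _ => ?_
    rw [map_sum, sum_Icc_parity, map_add, map_sum, map_sum]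
    · simp only [Nat.lt_succ_iff]
    · intro e he
      have h0 : modQ (N + 1) (q ^ ((2 * u + 1) * e)) = 0 := modQ_q_pow (by nlinarith)
      split_ifs <;> simp [h0]
  have h4 : evenPart l N m = ∑ u ∈ Finset.range N, ∑ e ∈ Finset.Icc 1 N,
        ((if u + m < 2 * e then q ^ ((2 * u + 1) * (2 * e)) else 0) -
          (if 2 * e + m ≤ u then q ^ ((2 * u + 1) * (2 * e)) else 0)) +
      ∑ u ∈ Finset.range N, ∑ e ∈ Finset.Icc 1 N,
        ((if (2 * l + 1) * e + m ≤ u then q ^ ((2 * u + 1) * (2 * e)) else 0) -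
          (if (2 * l + 1) * u + l + m < e then q ^ ((2 * u + 1) * (2 * e)) else 0)) := by
    simp only [evenPart, Finset.sum_add_distrib]
  rw [h1, map_add, h2, modQ_alphaC_part, modQ_unit_part, h3, h4, ← add_assoc, map_add _ (_ + _)]
  exact add_comm _ _

/-! ### Cancellation of the negative monomials -/

theorem isNonneg_ite_sub_ite {P Q : Prop} [Decidable P] [Decidable Q] (h : Q → P) (k : ℕ) :
    IsNonneg ((if P then q ^ k else 0) - (if Q then q ^ k else 0)) := by
  by_cases hP : P
  · by_cases hQ : Q
    · simpa [hP, hQ] using isNonneg_zero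
    · simpa [hP, hQ] using isNonneg_q_pow k
  · have hQ : ¬ Q := fun hQ => hP (h hQ)
    simpa [hP, hQ] using isNonneg_zero

/-- The exponent is symmetric in the two odd factors. After exchanging them in the negative sum, its
condition `2u + 1 + m ≤ w` implies the positive one `u + m ≤ 2w`. -/
theorem isNonneg_oddPart (N m : ℕ) : IsNonneg (oddPart N m) := by
  have h : oddPart N m = ∑ u ∈ Finset.range N, ∑ w ∈ Finset.range N,
      ((if u + m ≤ 2 * w then q ^ ((2 * u + 1) * (2 * w + 1)) else 0) -
        (if 2 * u + 1 + m ≤ w then q ^ ((2 * u + 1) * (2 * w + 1)) else 0)) := by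
    simp only [oddPart, Finset.sum_sub_distrib]
    congr 1
    rw [Finset.sum_comm]
    refine Finset.sum_congr rfl fun u _ => Finset.sum_congr rfl fun w _ => ?_
    rw [mul_comm (2 * w + 1)]
  rw [h]
  exact IsNonneg.sum fun u _ => IsNonneg.sum fun w _ => isNonneg_ite_sub_ite (by omega) _

/-- For `l = 0` the conditions are nested: `u + m < e` implies `u + m < 2e`, and `2e + m ≤ u`
implies `e + m ≤ u`. -/
theorem isNonneg_evenPart_zero (N m : ℕ) : IsNonneg (evenPart 0 N m) := by
  refine IsNonneg.sum fun u _ => IsNonneg.sum fun e _ => ?_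
  have h : ∀ a b c d : Ser, a - b + (c - d) = (a - d) + (c - b) := fun a b c d => by ring
  rw [h]
  exact (isNonneg_ite_sub_ite (by omega) _).add (isNonneg_ite_sub_ite (by omega) _)

theorem isNonneg_invPochEven (M : ℕ) : IsNonneg (invPochEven M) :=
  IsNonneg.prod fun _ _ => isNonneg_geom (by omega)

/-- The factor `1 - q^(2k+2)` cancels one of the denominators. -/
theorem isNonneg_invPochEven_mul_one_sub {M k : ℕ} (hk : k < M) :
    IsNonneg (invPochEven M * (1 - q ^ (2 * k + 2))) := by
  have h := Finset.mul_prod_erase (Finset.range M) (fun i => geom (q ^ (2 * i + 2)))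
    (Finset.mem_range.2 hk)
  have h2 := one_sub_q_pow_mul_geom (Nat.add_one_ne_zero (2 * k + 1))
  have e : invPochEven M * (1 - q ^ (2 * k + 2)) =
      ∏ i ∈ (Finset.range M).erase k, geom (q ^ (2 * i + 2)) := by
    rw [invPochEven, ← h]
    linear_combination (∏ i ∈ (Finset.range M).erase k, geom (q ^ (2 * i + 2))) * h2
  rw [e]
  exact IsNonneg.prod fun _ _ => isNonneg_geom (by omega)

theorem evenPart_one_eq (N m : ℕ) :
    evenPart 1 N m =
      ∑ x ∈ (Finset.range N ×ˢ Finset.Icc 1 N).filter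
          (fun x => x.1 + m < 2 * x.2 ∧ x.2 ≤ 3 * x.1 + 1 + m), q ^ ((2 * x.1 + 1) * (2 * x.2)) -
        ∑ x ∈ (Finset.range N ×ˢ Finset.Icc 1 N).filter
          (fun x => 2 * x.2 + m ≤ x.1 ∧ x.1 < 3 * x.2 + m), q ^ ((2 * x.1 + 1) * (2 * x.2)) := by
  rw [evenPart, Finset.sum_filter, Finset.sum_filter, ← Finset.sum_sub_distrib,
    Finset.sum_product]
  refine Finset.sum_congr rfl fun u _ => Finset.sum_congr rfl fun e _ => ?_
  dsimp only
  split_ifs <;> first | omega | ring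

/-- Every negative monomial of the even part is compensated by a positive one of smaller degree. -/
theorem isNonneg_invPochEven_mul_evenPart_one (N m : ℕ) :
    IsNonneg (invPochEven (2 * N ^ 2 + N) * evenPart 1 N m) := by
  rw [evenPart_one_eq]
  set S := (Finset.range N ×ˢ Finset.Icc 1 N).filter
    (fun x => x.1 + m < 2 * x.2 ∧ x.2 ≤ 3 * x.1 + 1 + m) with hS
  set T := (Finset.range N ×ˢ Finset.Icc 1 N).filter
    (fun x => 2 * x.2 + m ≤ x.1 ∧ x.1 < 3 * x.2 + m) with hT
  -- The negative exponent `(2u+1)·2e` exceeds that of its image, `(2e-1)·2(u-e)`, by `4e² + 2u`, an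
  -- even positive number.
  let φ : ℕ × ℕ → ℕ × ℕ := fun x => (x.2 - 1, x.1 - x.2)
  have hsub : T.image φ ⊆ S := by
    intro y hy
    obtain ⟨⟨u, e⟩, hx, rfl⟩ := Finset.mem_image.1 hy
    simp only [hT, hS, φ, Finset.mem_filter, Finset.mem_product, Finset.mem_range,
      Finset.mem_Icc] at hx ⊢
    omega
  have hinj : Set.InjOn φ T := by
    rintro ⟨u, e⟩ hx ⟨u', e'⟩ hx' h
    simp only [hT, Finset.coe_filter, Set.mem_ofPred_eq, Finset.mem_product, Finset.mem_range,
      Finset.mem_Icc] at hx hx'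
    simp only [φ, Prod.mk.injEq] at h ⊢
    omega
  rw [← Finset.sum_sdiff hsub, Finset.sum_image hinj, add_sub_assoc, ← Finset.sum_sub_distrib,
    mul_add, Finset.mul_sum, Finset.mul_sum]
  refine (IsNonneg.sum fun x _ => (isNonneg_invPochEven _).mul (isNonneg_q_pow _)).add
    (IsNonneg.sum fun x hx => ?_)
  obtain ⟨u, e⟩ := x
  simp only [hT, Finset.mem_filter, Finset.mem_product, Finset.mem_range, Finset.mem_Icc] at hx
  obtain ⟨v, rfl⟩ := Nat.exists_eq_add_of_le' hx.1.2.1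
  obtain ⟨w, rfl⟩ := Nat.exists_eq_add_of_le' (show v + 1 ≤ u by omega)
  -- Here `e = v + 1` and `u = w + v + 1`, so `2k + 2 = 4e² + 2u` for `k = 2e² + u - 1`. The bounds
  -- `e ≤ N` and `u < N` account for the product length `2N² + N`.
  have hk : 2 * (v + 1) ^ 2 + (w + v) < 2 * N ^ 2 + N := by
    have := Nat.pow_le_pow_left hx.1.2.2 2
    omega
  have e1 : invPochEven (2 * N ^ 2 + N) * (q ^ ((2 * (φ (w + (v + 1), v + 1)).1 + 1) *
      (2 * (φ (w + (v + 1), v + 1)).2)) - q ^ ((2 * (w + (v + 1)) + 1) * (2 * (v + 1)))) =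
      invPochEven (2 * N ^ 2 + N) * (1 - q ^ (2 * (2 * (v + 1) ^ 2 + (w + v)) + 2)) *
        q ^ ((2 * v + 1) * (2 * w)) := by
    simp only [φ, Nat.add_sub_cancel]
    ring
  rw [e1]
  exact (isNonneg_invPochEven_mul_one_sub hk).mul (isNonneg_q_pow _)

theorem isNonneg_SC1 : IsNonneg SC1 := by
  refine isNonneg_tsum_factor (fun _ => 0) (alphaDiff (alphaC 1)) (fun N => 2 * N ^ 2 + N)
    (fun N => Nat.le_add_left _ _) (fun n hn => ?_) (fun N m => ?_)
  · rw [sum_alphaDiff _ hn, baileyPair_C1, pow_zero, one_mul]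
  · refine ⟨invPochEven (2 * N ^ 2 + N) * (oddPart N m + evenPart 1 N m), ?_,
      by rw [map_mul, modQ_lambert, ← map_mul]⟩
    rw [mul_add]
    exact ((isNonneg_invPochEven _).mul (isNonneg_oddPart N m)).add
      (isNonneg_invPochEven_mul_evenPart_one N m)

theorem isNonneg_SC5 : IsNonneg SC5 := by
  have h := isNonneg_tsum_factor (fun n => n * (n - 1) / 2) (alphaDiff (alphaC 0)) (fun N => N)
    (fun N => le_rfl) (fun n hn => by rw [sum_alphaDiff _ hn, baileyPair_C5]) (fun N m => by
      refine ⟨invPochEven N * (oddPart N m + evenPart 0 N m), ?_,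
        by rw [map_mul, modQ_lambert, ← map_mul]⟩
      exact (isNonneg_invPochEven _).mul ((isNonneg_oddPart N m).add (isNonneg_evenPart_zero N m)))
  have e : ∀ k : ℕ, (k + 1) * (k + 2) / 2 = k + 1 + (k + 1) * (k + 1 - 1) / 2 := by
    intro k
    rw [Nat.add_sub_cancel, show (k + 1) * (k + 2) = (k + 1) * k + (k + 1) * 2 by ring,
      Nat.add_mul_div_right _ _ (by norm_num), add_comm]
  simpa only [SC5, e] using h

end SptCrank

end

theorem mainTheorem4 :
    (∀ (m : ℤ) (n : ℕ), 0 ≤ SptCrank.MC1 m n) ∧ (∀ (m : ℤ) (n : ℕ), 0 ≤ SptCrank.MC5 m n) :=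
  ⟨SptCrank.isNonneg_SC1, SptCrank.isNonneg_SC5⟩
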